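/- Let $\tfrac12<\alpha<1$, $C\in\mathbb R$, and put $\beta:=2\alpha+1\in(2,3)$. For $n\in\mathbb N$ let $R:=2\ln n+C$. The hyperbolic random graph $\mathcal G(n,\alpha,C)$ has $n$ nodes with independent random polar coordinates $(r_v,\varphi_v)$ in the hyperbolic plane, where $\varphi_v$ is uniform on $[0,2\pi)$ and $r_v\in[0,R]$ is independent of $\varphi_v$ with density $\rho(r)=\frac{\alpha\sinh(\alpha r)}{\cosh(\alpha R)-1}$; two distinct nodes $u,v$ are adjacent if and only if their hyperbolic distance $$\cosh^{-1}\bigl(\cosh r_u\cosh r_v-\sinh r_u\sinh r_v\cos(\varphi_u-\varphi_v)\bigr)$$ is at most $R$. Then the diameter (with respect to graph distance) of the giant component, i.e. of the connected component with the largest number of nodes (of each of them, in case of a tie), of $\mathcal G(n,\alpha,C)$ is $\mathcal O\bigl((\log n)^{2/(3-\beta)}\bigr)$ with probability $1-\mathcal O(n^{-3/2})$. That is, there are constants $A,B>0$ and $N\in\mathbb N$, depending only on $\alpha$ and $C$, such that for all $n\ge N$ this diameter exceeds $A(\log n)^{2/(3-\beta)}$ with probability at most $B\,n^{-3/2}$.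 -/

import Mathlib

open MeasureTheory

noncomputable section

namespace HyperbolicRandomGraph

/-- The radius `R = 2 log n + C` of the disc `D_n`; it is also the connection threshold. -/
def discRadius (n : ℕ) (C : ℝ) : ℝ := 2 * Real.log n + C

/-- The radial density `ρ(r) = α sinh(α r) / (cosh(α R) - 1)`, to be used on `[0, R]`. -/
def radialDensity (α R r : ℝ) : ℝ :=
  α * Real.sinh (α * r) / (Real.cosh (α * R) - 1)

/-- The law of the radial coordinate of a node: density `radialDensity α R` on `[0, R]`. -/
def radialLaw (α R : ℝ) : Measure ℝ :=
  (volume.restrict (Set.Icc 0 R)).withDensity fun r => ENNReal.ofReal (radialDensity α R r)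

/-- The uniform distribution on `[0, 2π)`. -/
def angularLaw : Measure ℝ :=
  ProbabilityTheory.cond volume (Set.Ico 0 (2 * Real.pi))

/-- The law of one node, given by its polar coordinates `(r, φ)`: the two coordinates are
independent. -/
def nodeLaw (α R : ℝ) : Measure (ℝ × ℝ) := (radialLaw α R).prod angularLaw

/-- The joint law of the `n` independent nodes of `G(n, α, C)`. -/
def nodesLaw (n : ℕ) (α C : ℝ) : Measure (Fin n → ℝ × ℝ) :=
  Measure.pi fun _ => nodeLaw α (discRadius n C)

/-- The small relative angle (in `[0, π]`) between two angular coordinates. -/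
def relAngle (φ ψ : ℝ) : ℝ := Real.arccos (Real.cos (φ - ψ))

/-- The hyperbolic distance of two points given in (native) polar coordinates `(r, φ)`. -/
def hypDist (u v : ℝ × ℝ) : ℝ :=
  Real.arcosh (Real.cosh u.1 * Real.cosh v.1
    - Real.sinh u.1 * Real.sinh v.1 * Real.cos (relAngle u.2 v.2))

theorem hypDist_comm (u v : ℝ × ℝ) : hypDist u v = hypDist v u := by
  have h : relAngle u.2 v.2 = relAngle v.2 u.2 := by
    unfold relAngle
    rw [← Real.cos_neg, neg_sub]
  unfold hypDist
  rw [h, mul_comm (Real.cosh u.1), mul_comm (Real.sinh u.1)]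

/-- The graph on `n` nodes at the positions `p`: distinct nodes are joined if and only if their
hyperbolic distance is at most `R = 2 log n + C`. Under `nodesLaw n α C` this is the hyperbolic
random graph `G(n, α, C)`. -/
def graph (n : ℕ) (C : ℝ) (p : Fin n → ℝ × ℝ) : SimpleGraph (Fin n) where
  Adj i j := i ≠ j ∧ hypDist (p i) (p j) ≤ discRadius n C
  symm := ⟨fun i j h => ⟨h.1.symm, by rw [hypDist_comm]; exact h.2⟩⟩
  loopless := ⟨fun _ h => h.1 rfl⟩

/-- A giant component: a connected component with the largest number of vertices. -/
def IsGiant {V : Type*} {G : SimpleGraph V} (K : G.ConnectedComponent) : Prop :=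
  ∀ K' : G.ConnectedComponent, K'.supp.ncard ≤ K.supp.ncard

end HyperbolicRandomGraph

end

/-! ### Hyperbolic geometry of adjacency. -/

namespace HyperbolicRandomGraph

/-! Cut the disc into layers at depth `h = R - r`, with `h = h₀ + j` for `j ≤ J`, and cut the layer
at depth `h` into about `8 exp(R/2 - h)` equal sectors. A cell then holds at least of order `exp((1
- α) h)` nodes in expectation (`le_expected_cell`), so a depth `h₀` with `exp h₀` of order `(log n)
^ (1 / (1 - α))`, which is `(log n) ^ (2 / (3 - β))`, makes all cells nonempty outside an event of
small probability. A Chernoff bound (`pi_le_card_filter_le`) leaves at most `M = O(exp h₀)` nodes in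
each sector of layer `0`.

Given these two events the rest is deterministic (`diam_le_of_cells`). A node at depth at least `h₀`
climbs inwards one layer per edge (`coshDist_le_of_mem_sector`) and reaches the clique of radius at
most `R/2` in `J = O(log n)` steps. An outer node lies on an arc of three sectors delimited by two
nodes at depth at least `h₀`. An edge jumping over such a delimiter forces its outer endpoint to be
adjacent to one (`adj_mem_arc`). So within `3M` steps the node gets next to depth `h₀`, or its
component is trapped among the `3M` nodes of the arc. This bounds the diameter of every component by
`O(M + J)`. -/

/-- The hyperbolic cosine of the distance of two points with radii `r`, `s` and relative angle
of cosine `c`. -/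
noncomputable def coshDist (r s c : ℝ) : ℝ :=
  Real.cosh r * Real.cosh s - Real.sinh r * Real.sinh s * c

theorem coshDist_eq (r s c : ℝ) :
    coshDist r s c = Real.cosh (r - s) + Real.sinh r * Real.sinh s * (1 - c) := by
  rw [coshDist, Real.cosh_sub]; ring

theorem one_le_coshDist {r s c : ℝ} (hr : 0 ≤ r) (hs : 0 ≤ s) (hc : c ≤ 1) :
    1 ≤ coshDist r s c := by
  have h1 := Real.one_le_cosh (r - s)
  have h2 := mul_nonneg (mul_nonneg (Real.sinh_nonneg_iff.2 hr) (Real.sinh_nonneg_iff.2 hs))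
    (sub_nonneg.2 hc)
  rw [coshDist_eq]; linarith

theorem coshDist_anti {r s c c' : ℝ} (hr : 0 ≤ r) (hs : 0 ≤ s) (hc : c ≤ c') :
    coshDist r s c' ≤ coshDist r s c := by
  have h2 := mul_nonneg (Real.sinh_nonneg_iff.2 hr) (Real.sinh_nonneg_iff.2 hs)
  unfold coshDist
  nlinarith

/-- Balls around a point at distance at most `R` from the origin are star-shaped. -/
theorem coshDist_le_of_radius_le {r s s' c R : ℝ} (hr : 0 ≤ r) (hrR : r ≤ R)
    (hs' : 0 ≤ s') (hss : s' ≤ s) (hc : |c| ≤ 1) (h : coshDist r s c ≤ Real.cosh R) :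
    coshDist r s' c ≤ Real.cosh R := by
  have hcosh : Real.cosh r ≤ Real.cosh R := by
    rw [Real.cosh_le_cosh, abs_of_nonneg hr, abs_of_nonneg (hr.trans hrR)]; exact hrR
  rcases hs'.eq_or_lt with h0 | h0
  · subst h0; simpa [coshDist] using hcosh
  have hs : 0 < s := h0.trans_le hss
  have hsr : Real.sinh r ≤ Real.cosh r := (Real.sinh_lt_cosh r).le
  have hsr0 : 0 ≤ Real.sinh r := Real.sinh_nonneg_iff.2 hr
  obtain ⟨hc1, hc2⟩ := abs_le.1 hc
  have hA : 0 ≤ (Real.cosh r - Real.sinh r * c) / 2 := by nlinarith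
  have hB : 0 ≤ (Real.cosh r + Real.sinh r * c) / 2 := by nlinarith
  -- With `r` and `c` fixed, `coshDist` is a nonnegative combination of `exp x` and `exp (-x)`,
  -- hence convex, so its value at `s'` is at most the larger of those at `0` and `s`.
  have hconv : ConvexOn ℝ Set.univ fun x : ℝ =>
      (Real.cosh r - Real.sinh r * c) / 2 * Real.exp x
        + (Real.cosh r + Real.sinh r * c) / 2 * Real.exp (-x) := by
    refine (convexOn_exp.smul hA).add (ConvexOn.smul hB ?_)
    have := convexOn_exp.comp_linearMap (-LinearMap.id (R := ℝ) (M := ℝ))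
    simpa [Function.comp_def] using this
  have hform : ∀ x, coshDist r x c = (Real.cosh r - Real.sinh r * c) / 2 * Real.exp x
        + (Real.cosh r + Real.sinh r * c) / 2 * Real.exp (-x) := by
    intro x
    rw [coshDist, Real.cosh_eq x, Real.sinh_eq x]; ring
  have hmem : s' ∈ segment ℝ 0 s := by
    rw [segment_eq_Icc hs.le]; exact ⟨hs', hss⟩
  have := hconv.le_max_of_mem_segment (Set.mem_univ 0) (Set.mem_univ s) hmem
  simp only [← hform] at this
  refine this.trans (max_le ?_ h)
  simpa [coshDist] using hcosh

theorem hypDist_le_iff {u v : ℝ × ℝ} {R : ℝ} (hu : 0 ≤ u.1) (hv : 0 ≤ v.1) (hR : 0 ≤ R) :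
    hypDist u v ≤ R ↔ coshDist u.1 v.1 (Real.cos (u.2 - v.2)) ≤ Real.cosh R := by
  have hcos : Real.cos (relAngle u.2 v.2) = Real.cos (u.2 - v.2) :=
    Real.cos_arccos (Real.neg_one_le_cos _) (Real.cos_le_one _)
  have h1 := one_le_coshDist hu hv (Real.cos_le_one (u.2 - v.2))
  have : hypDist u v = Real.arcosh (coshDist u.1 v.1 (Real.cos (u.2 - v.2))) := by
    rw [hypDist, hcos, coshDist]
  rw [this]
  conv_lhs => rw [← Real.arcosh_cosh hR]
  exact Real.arcosh_le_arcosh (by linarith) (Real.cosh_pos R)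

theorem coshDist_le_of_add_le {r s c R : ℝ} (hr : 0 ≤ r) (hs : 0 ≤ s) (hc : -1 ≤ c)
    (h : r + s ≤ R) : coshDist r s c ≤ Real.cosh R := by
  refine (coshDist_anti hr hs hc).trans ?_
  have : coshDist r s (-1) = Real.cosh (r + s) := by rw [coshDist, Real.cosh_add]; ring
  rw [this, Real.cosh_le_cosh, abs_of_nonneg (by linarith), abs_of_nonneg (by linarith)]
  exact h

/-- Each of the two terms of `coshDist_eq` is at most `exp R / 4`: the first because `cosh 2 ≤ exp
2`, the second because it is at most `θ² exp(r + s) / 8`. -/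
theorem coshDist_le_of_angle_le {r s θ R : ℝ} (hr : 0 ≤ r) (hs : 0 ≤ s)
    (hrs : |r - s| ≤ 2) (hR : 4 ≤ R) (h : θ ^ 2 * Real.exp (r + s) ≤ 2 * Real.exp R) :
    coshDist r s (Real.cos θ) ≤ Real.cosh R := by
  have h1 : Real.cosh (r - s) ≤ Real.exp 2 := by
    have : Real.cosh (r - s) ≤ Real.cosh 2 := by
      rw [Real.cosh_le_cosh, abs_of_pos (by norm_num : (0 : ℝ) < 2)]; exact hrs
    refine this.trans ?_
    rw [Real.cosh_eq]
    have : Real.exp (-2) ≤ Real.exp 2 := Real.exp_le_exp.2 (by norm_num)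
    linarith
  have h2 : Real.exp 2 ≤ Real.exp R / 4 := by
    have e1 : Real.exp R = Real.exp 2 * Real.exp (R - 2) := by rw [← Real.exp_add]; ring_nf
    have e2 : (4 : ℝ) ≤ Real.exp (R - 2) := by
      have : Real.exp 2 ≤ Real.exp (R - 2) := Real.exp_le_exp.2 (by linarith)
      have e3 : Real.exp 2 = Real.exp 1 * Real.exp 1 := by rw [← Real.exp_add]; norm_num
      have := Real.add_one_le_exp (1 : ℝ)
      nlinarith
    rw [e1]; nlinarith [Real.exp_pos 2]
  have h3 : Real.sinh r ≤ Real.exp r / 2 := by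
    rw [Real.sinh_eq]; have := Real.exp_pos (-r); linarith
  have h4 : Real.sinh s ≤ Real.exp s / 2 := by
    rw [Real.sinh_eq]; have := Real.exp_pos (-s); linarith
  have h5 : 1 - Real.cos θ ≤ θ ^ 2 / 2 := by
    have := Real.one_sub_sq_div_two_le_cos (x := θ); linarith
  have h6 : 0 ≤ 1 - Real.cos θ := sub_nonneg.2 (Real.cos_le_one _)
  have h7 : Real.sinh r * Real.sinh s * (1 - Real.cos θ)
      ≤ (Real.exp r / 2) * (Real.exp s / 2) * (θ ^ 2 / 2) := by
    have := Real.sinh_nonneg_iff.2 hr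
    have := Real.sinh_nonneg_iff.2 hs
    gcongr
  have h8 : Real.exp R / 2 ≤ Real.cosh R := by
    rw [Real.cosh_eq]; have := Real.exp_pos (-R); linarith
  rw [Real.exp_add] at h
  rw [coshDist_eq]
  nlinarith

/-- An arc that starts in `[0, L]` and ends in `[L, 2π]` passes through `0` or `L`. -/
theorem cos_sub_le_of_separated {x y L : ℝ} (hx : 0 ≤ x) (hxL : x ≤ L) (hLy : L ≤ y)
    (hy : y ≤ 2 * Real.pi) :
    Real.cos (y - x) ≤ Real.cos (L - x) ∨ Real.cos (y - x) ≤ Real.cos x := by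
  rcases le_total (y - x) Real.pi with h | h
  · left
    exact Real.cos_le_cos_of_nonneg_of_le_pi (by linarith) h (by linarith)
  · right
    have : Real.cos (y - x) = Real.cos (2 * Real.pi - (y - x)) := (Real.cos_two_pi_sub _).symm
    rw [this]
    exact Real.cos_le_cos_of_nonneg_of_le_pi hx (by linarith) (by linarith)

end HyperbolicRandomGraph

/-! ### Graph-theoretic bounds on walks and diameters. -/

namespace SimpleGraph

variable {V : Type*} {G : SimpleGraph V}

/-- If walks can leave `T` only after visiting `D`, then starting in `T` one either gets to `D`
within `#T` steps or stays in `T`. -/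
theorem exists_walk_length_le_card_or_reachable_subset (T : Finset V) (D : Set V)
    (hT : ∀ u ∈ T, u ∉ D → ∀ u', G.Adj u u' → u' ∈ T) {v : V} (hv : v ∈ T) :
    (∃ d ∈ D, ∃ w : G.Walk v d, w.length ≤ T.card) ∨ ∀ y, G.Reachable v y → y ∈ T := by
  classical
  by_cases h : ∃ l : ℕ, ∃ d ∈ D, ∃ w : G.Walk v d, w.length = l
  · left
    obtain ⟨d, hd, w, hw⟩ := Nat.find_spec h
    have hmin : ∀ d' ∈ D, ∀ w' : G.Walk v d', w.length ≤ w'.length := by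
      intro d' hd' w'
      rw [hw]
      exact Nat.find_min' h ⟨d', hd', w', rfl⟩
    refine ⟨d, hd, w, ?_⟩
    -- A walk to `D` of minimal length is a path and meets `D` only at its end, so its vertices
    -- before the end are distinct and stay in `T`.
    have hpath : w.IsPath := by
      apply Walk.isPath_of_length_eq_dist
      apply le_antisymm _ (dist_le w)
      obtain ⟨q, hq⟩ := w.reachable.exists_walk_length_eq_dist
      rw [← hq]; exact hmin d hd q
    have hnot : ∀ i < w.length, w.getVert i ∉ D := by
      intro i hi hD
      have := hmin _ hD (w.take i)
      rw [Walk.take_length] at this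
      omega
    have hmem : ∀ i ≤ w.length, w.getVert i ∈ T := by
      intro i
      induction i with
      | zero => intro _; simpa using hv
      | succ i ih =>
        intro hi
        exact hT _ (ih (by omega)) (hnot i (by omega)) _ (w.adj_getVert_succ (by omega))
    have hinj := hpath.getVert_injOn
    have := Finset.card_le_card_of_injOn (s := Finset.range w.length) (t := T) w.getVert
      (fun i hi => hmem i (by simpa using (Finset.mem_range.1 hi).le))
      (fun i hi j hj hij => hinj (by simpa using (Finset.mem_range.1 hi).le)
        (by simpa using (Finset.mem_range.1 hj).le) hij)
    simpa using this
  · right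
    rintro y ⟨w⟩
    have key : ∀ x z (q : G.Walk x z), x ∈ T → G.Reachable v x → z ∈ T := by
      intro x z q
      induction q with
      | nil => exact fun h _ => h
      | cons hadj q ih =>
        intro hx hr
        refine ih (hT _ hx ?_ _ hadj) (hr.trans hadj.reachable)
        intro hD
        obtain ⟨q'⟩ := hr
        exact h ⟨_, _, hD, q', rfl⟩
    exact key v y w hv (Reachable.refl v)

/-- Each level costs at most one edge. Below, `P j` says that a node lies at depth at least `h₀ +
j`. -/
theorem exists_walk_of_ladder (P : ℕ → V → Prop) (J : ℕ)
    (hP : ∀ j < J, ∀ v, P j v → P (j + 1) v ∨ ∃ u, G.Adj v u ∧ P (j + 1) u) :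
    ∀ v, P 0 v → ∃ c, P J c ∧ ∃ w : G.Walk v c, w.length ≤ J := by
  intro v hv
  induction J with
  | zero => exact ⟨v, hv, .nil, by simp⟩
  | succ J ih =>
    obtain ⟨c, hc, w, hw⟩ := ih fun j hj => hP j (by omega)
    rcases hP J (by omega) c hc with h | ⟨u, hadj, hu⟩
    · exact ⟨c, h, w, by omega⟩
    · exact ⟨u, hu, w.concat hadj, by simpa using hw⟩

/-- If every vertex is close to a clique or in a small component, then all distances are small. -/
theorem exists_walk_length_le_of_clique_or_small (Z : Set V) (a m : ℕ)
    (hZ : ∀ x ∈ Z, ∀ y ∈ Z, x ≠ y → G.Adj x y)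
    (hv : ∀ v, (∃ z ∈ Z, ∃ w : G.Walk v z, w.length ≤ a) ∨
      ∃ T : Finset V, T.card ≤ m ∧ ∀ y, G.Reachable v y → y ∈ T)
    (hm : m ≤ 2 * a + 1) {u v : V} (huv : G.Reachable u v) :
    ∃ w : G.Walk u v, w.length ≤ 2 * a + 1 := by
  classical
  have small : ∀ u v : V, G.Reachable u v →
      (∃ T : Finset V, T.card ≤ m ∧ ∀ y, G.Reachable u y → y ∈ T) →
      ∃ w : G.Walk u v, w.length ≤ 2 * a + 1 := by
    rintro u v huv ⟨T, hT, hsub⟩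
    obtain ⟨w, hw⟩ := huv.exists_isPath
    refine ⟨w, ?_⟩
    have h1 : w.support.toFinset ⊆ T := by
      intro x hx
      exact hsub x ((w.takeUntil x (by simpa using hx)).reachable)
    have h2 := Finset.card_le_card h1
    rw [List.toFinset_card_of_nodup hw.support_nodup, Walk.length_support] at h2
    omega
  rcases hv u with ⟨x, hx, w, hw⟩ | h
  · rcases hv v with ⟨y, hy, q, hq⟩ | h
    · by_cases hxy : x = y
      · subst hxy
        exact ⟨w.append q.reverse, by simp; omega⟩
      · exact ⟨(w.concat (hZ x hx y hy hxy)).append q.reverse, by simp; omega⟩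
    · obtain ⟨w, hw⟩ := small v u huv.symm h
      exact ⟨w.reverse, by simpa using hw⟩
  · exact small u v huv h

theorem ConnectedComponent.diam_toSimpleGraph_le (m : ℕ)
    (h : ∀ u v : V, G.Reachable u v → ∃ w : G.Walk u v, w.length ≤ m)
    (K : G.ConnectedComponent) : K.toSimpleGraph.diam ≤ m := by
  classical
  -- Bounding the extended diameter matters: `diam` would be `0` by default if `ediam` were
  -- infinite.
  have : K.toSimpleGraph.ediam ≤ m := by
    refine ediam_le_of_edist_le ?_
    rintro ⟨u, hu⟩ ⟨v, hv⟩
    have huv : G.Reachable u v := ConnectedComponent.exact (hu.trans hv.symm)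
    obtain ⟨w, hw⟩ := h u v huv
    have hs : ∀ x ∈ w.support, x ∈ K.supp := by
      intro x hx
      exact (ConnectedComponent.sound (w.takeUntil x hx).reachable.symm).trans hu
    refine (edist_le (w.induce K.supp hs)).trans ?_
    rw [← Walk.length_map (Embedding.induce K.supp).toHom, Walk.map_induce]
    exact_mod_cast hw
  exact ENat.toNat_le_of_le_natCast this

end SimpleGraph

/-! ### Sectors and the deterministic diameter bound. -/

namespace HyperbolicRandomGraph

/-- The `i`-th of `N` equal sectors of the circle, lifted to the real line. -/
def sector (N : ℕ) (i : ℤ) : Set ℝ :=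
  Set.Ico (2 * Real.pi * (i / N)) (2 * Real.pi * ((i + 1) / N))

theorem abs_sub_le_of_mem_sector {N : ℕ} {i : ℤ} {φ ψ : ℝ} (hφ : φ ∈ sector N i)
    (hψ : ψ ∈ sector N i) : |φ - ψ| ≤ 2 * Real.pi / N := by
  obtain ⟨h1, h2⟩ := hφ
  obtain ⟨h3, h4⟩ := hψ
  have : 2 * Real.pi * (((i : ℝ) + 1) / N) = 2 * Real.pi * (i / N) + 2 * Real.pi / N := by ring
  rw [this] at h2 h4
  rw [abs_le]; constructor <;> linarith

theorem mem_sector_iff {N : ℕ} (hN : 0 < N) {i : ℤ} {φ : ℝ} :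
    φ ∈ sector N i ↔ ⌊φ * N / (2 * Real.pi)⌋ = i := by
  have hN' : (0 : ℝ) < N := by exact_mod_cast hN
  have hpi := Real.two_pi_pos
  rw [Int.floor_eq_iff, sector, Set.mem_Ico, le_div_iff₀ hpi, div_lt_iff₀ hpi, ← mul_div_assoc,
    ← mul_div_assoc, div_le_iff₀ hN', lt_div_iff₀ hN', mul_comm (2 * Real.pi),
    mul_comm (2 * Real.pi)]

/-- Integer indices and lifted angles let neighbouring sectors `k - 1`, `k + 1` wrap around the
circle without case distinctions. -/
theorem add_mem_sector_iff {N : ℕ} (hN : 0 < N) {i m : ℤ} {φ : ℝ} :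
    φ + 2 * Real.pi * m ∈ sector N i ↔ φ ∈ sector N (i - m * N) := by
  have hN' : (0 : ℝ) < N := by exact_mod_cast hN
  have hpi := Real.two_pi_pos
  rw [mem_sector_iff hN, mem_sector_iff hN]
  have : (φ + 2 * Real.pi * m) * N / (2 * Real.pi) = φ * N / (2 * Real.pi) + ((m * N : ℤ) : ℝ) := by
    push_cast; field_simp
  rw [this, Int.floor_add_intCast]
  omega

theorem exists_mem_sector {N : ℕ} (hN : 0 < N) {φ : ℝ}
    (hφ : φ ∈ Set.Ico 0 (2 * Real.pi)) : ∃ i : ℕ, i < N ∧ φ ∈ sector N i := by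
  have hN' : (0 : ℝ) < N := by exact_mod_cast hN
  have hpi := Real.two_pi_pos
  have h0 : 0 ≤ ⌊φ * N / (2 * Real.pi)⌋ :=
    Int.floor_nonneg.2 (div_nonneg (mul_nonneg hφ.1 hN'.le) hpi.le)
  have h1 : ⌊φ * N / (2 * Real.pi)⌋ < N := by
    rw [Int.floor_lt, div_lt_iff₀ hpi, mul_comm]
    push_cast
    exact mul_lt_mul_of_pos_left hφ.2 hN'
  refine ⟨⌊φ * N / (2 * Real.pi)⌋.toNat, by omega, ?_⟩
  rw [mem_sector_iff hN]; omega

theorem graph_adj_iff {n : ℕ} {C : ℝ} {p : Fin n → ℝ × ℝ} {u v : Fin n}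
    (hu : 0 ≤ (p u).1) (hv : 0 ≤ (p v).1) (hR : 0 ≤ discRadius n C) :
    (graph n C p).Adj u v ↔ u ≠ v ∧
      coshDist (p u).1 (p v).1 (Real.cos ((p u).2 - (p v).2)) ≤ Real.cosh (discRadius n C) := by
  rw [← hypDist_le_iff hu hv hR]; rfl

/-- The factor `8` makes the angle at most `(π/4) exp(h - R/2)`, while `r + s ≤ 2(R - h) + 1`. The
product needed in `coshDist_le_of_angle_le` is then at most `(π² e / 16) exp R`, and `π² e / 16 <
2`. -/
theorem coshDist_le_of_mem_sector {R h r s φ ψ : ℝ} {N : ℕ} {i : ℤ} (hR : 4 ≤ R)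
    (hr : 0 ≤ r) (hs : 0 ≤ s) (hr' : r ∈ Set.Icc (R - h) (R - h + 1))
    (hs' : s ∈ Set.Icc (R - h - 1) (R - h)) (hN : 8 * Real.exp (R / 2 - h) ≤ N)
    (hφ : φ ∈ sector N i) (hψ : ψ ∈ sector N i) :
    coshDist r s (Real.cos (φ - ψ)) ≤ Real.cosh R := by
  obtain ⟨hr1, hr2⟩ := hr'
  obtain ⟨hs1, hs2⟩ := hs'
  refine coshDist_le_of_angle_le hr hs (by rw [abs_le]; constructor <;> linarith) hR ?_
  have hE := Real.exp_pos (R / 2 - h)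
  have hNpos : (0 : ℝ) < N := by linarith
  have h1 : (φ - ψ) ^ 2 ≤ (2 * Real.pi / N) ^ 2 :=
    sq_le_sq.2 ((abs_sub_le_of_mem_sector hφ hψ).trans (le_abs_self _))
  have h2 : 2 * Real.pi / N ≤ 2 * Real.pi / (8 * Real.exp (R / 2 - h)) := by
    have := Real.pi_pos
    gcongr
  have h3 : Real.exp (r + s) ≤ Real.exp 1 * Real.exp R * Real.exp (R / 2 - h) ^ 2 := by
    rw [sq, ← Real.exp_add, ← Real.exp_add, ← Real.exp_add]
    exact Real.exp_le_exp.2 (by linarith)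
  have h4 : (φ - ψ) ^ 2 ≤ (2 * Real.pi / (8 * Real.exp (R / 2 - h))) ^ 2 := by
    have := Real.pi_pos
    refine h1.trans (pow_le_pow_left₀ (by positivity) h2 2)
  calc (φ - ψ) ^ 2 * Real.exp (r + s)
      ≤ (2 * Real.pi / (8 * Real.exp (R / 2 - h))) ^ 2 *
        (Real.exp 1 * Real.exp R * Real.exp (R / 2 - h) ^ 2) := by gcongr
    _ = (Real.pi ^ 2 * Real.exp 1 / 16) * Real.exp R := by field_simp; ring
    _ ≤ 2 * Real.exp R := by
      have h5 := Real.pi_lt_d2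
      have h6 := Real.exp_one_lt_d9
      have h7 := Real.pi_pos
      have h8 := Real.exp_pos (1 : ℝ)
      have : Real.pi ^ 2 ≤ 10 := by nlinarith
      gcongr
      nlinarith

/-- A node that is not joined to any node of radius at most `ρ` has all its neighbours within any
arc containing it that is delimited by two nodes of radius at most `ρ`. -/
theorem adj_mem_arc {n : ℕ} {C ρ : ℝ} {p : Fin n → ℝ × ℝ} (hR : 0 ≤ discRadius n C)
    (hp : ∀ u, (p u).1 ∈ Set.Icc 0 (discRadius n C)) {a b u u' : Fin n} {ma mb m : ℤ}
    (ha : (p a).1 ≤ ρ) (hb : (p b).1 ≤ ρ) (hu : ρ < (p u).1)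
    (hnadj : ∀ w, (p w).1 ≤ ρ → ¬ (graph n C p).Adj u w)
    (hmem : (p u).2 + 2 * Real.pi * m ∈
      Set.Icc ((p a).2 + 2 * Real.pi * ma) ((p b).2 + 2 * Real.pi * mb))
    (hadj : (graph n C p).Adj u u') :
    ∃ m' : ℤ, (p u').2 + 2 * Real.pi * m' ∈
      Set.Icc ((p a).2 + 2 * Real.pi * ma) ((p b).2 + 2 * Real.pi * mb) := by
  have hu' : ρ < (p u').1 := by
    by_contra! h
    exact hnadj u' h hadj
  by_contra! hout
  have hpi := Real.two_pi_pos
  set A := (p a).2 + 2 * Real.pi * ma with hA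
  set B := (p b).2 + 2 * Real.pi * mb with hB
  -- Lift `u'` to the full turn starting at `A`. Being off the arc, it must lie in `[B, A + 2π]`.
  obtain ⟨m', hm1, hm2⟩ : ∃ m' : ℤ, A ≤ (p u').2 + 2 * Real.pi * m' ∧
      (p u').2 + 2 * Real.pi * m' ≤ A + 2 * Real.pi := by
    refine ⟨⌈(A - (p u').2) / (2 * Real.pi)⌉, ?_, ?_⟩
    · have := Int.le_ceil ((A - (p u').2) / (2 * Real.pi))
      rw [div_le_iff₀ hpi] at this
      linarith
    · have := (Int.ceil_lt_add_one ((A - (p u').2) / (2 * Real.pi))).le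
      rw [← sub_le_iff_le_add, le_div_iff₀ hpi] at this
      linarith
  have hlt : B ≤ (p u').2 + 2 * Real.pi * m' := by
    by_contra! h
    exact hout m' ⟨hm1, h.le⟩
  have hcos := (graph_adj_iff (hp u).1 (hp u').1 hR).1 hadj
  -- A node closer to `u` in angle than `u'` and of smaller radius is also adjacent to `u`, by
  -- monotonicity in the angle and star-shapedness of balls.
  have key : ∀ w, (p w).1 ≤ ρ →
      Real.cos ((p u).2 - (p u').2) ≤ Real.cos ((p u).2 - (p w).2) → False := by
    intro w hw hle
    refine hnadj w hw ((graph_adj_iff (hp u).1 (hp w).1 hR).2 ⟨?_, ?_⟩)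
    · rintro rfl; linarith
    · refine coshDist_le_of_radius_le (hp u).1 (hp u).2 (hp w).1 (hw.trans hu'.le)
        (Real.abs_cos_le_one _) ?_
      exact (coshDist_anti (hp u).1 (hp u').1 hle).trans hcos.2
  have shift : ∀ (x y : ℝ) (k l : ℤ),
      Real.cos ((y + 2 * Real.pi * l) - (x + 2 * Real.pi * k)) = Real.cos (x - y) := by
    intro x y k l
    have : (y + 2 * Real.pi * l) - (x + 2 * Real.pi * k) = (y - x) + ((l - k : ℤ) : ℝ) * (2 * Real.pi) := by
      push_cast; ring
    rw [this, Real.cos_add_int_mul_two_pi, ← Real.cos_neg, neg_sub]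
  rcases cos_sub_le_of_separated (x := (p u).2 + 2 * Real.pi * m - A)
    (y := (p u').2 + 2 * Real.pi * m' - A) (L := B - A) (by linarith [hmem.1])
    (by linarith [hmem.2]) (by linarith) (by linarith) with h | h
  · refine key b hb ?_
    rw [sub_sub_sub_cancel_right, sub_sub_sub_cancel_right, shift, shift] at h
    exact h
  · refine key a ha ?_
    rw [sub_sub_sub_cancel_right, shift, ← Real.cos_neg, neg_sub, shift, ← Real.cos_neg,
      neg_sub] at h
    rw [← Real.cos_neg ((p u).2 - (p a).2), neg_sub]
    exact h

/-- The bound on the diameters of all components, provided that the cells of a layered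
decomposition are nonempty and that the sectors of the outermost layer are not too crowded. -/
theorem diam_le_of_cells {n : ℕ} {C h₀ : ℝ} {p : Fin n → ℝ × ℝ} (J M : ℕ) (N : ℕ → ℕ)
    (hR : 4 ≤ discRadius n C)
    (hp : ∀ u, p u ∈ Set.Icc 0 (discRadius n C) ×ˢ Set.Ico 0 (2 * Real.pi))
    (hN : ∀ j ≤ J, 8 * Real.exp (discRadius n C / 2 - (h₀ + j)) ≤ N j)
    (hJ : discRadius n C / 2 ≤ h₀ + J)
    (hcell : ∀ j ≤ J, ∀ i < N j, ∃ u, p u ∈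
      Set.Icc (discRadius n C - (h₀ + j) - 1) (discRadius n C - (h₀ + j)) ×ˢ sector (N j) i)
    (hM : ∀ i < N 0, ∀ T : Finset (Fin n), (∀ u ∈ T, (p u).2 ∈ sector (N 0) i) → T.card ≤ M)
    (K : (graph n C p).ConnectedComponent) :
    K.toSimpleGraph.diam ≤ 2 * (3 * M + 1 + J) + 1 := by
  classical
  set R := discRadius n C with hRdef
  have hR0 : 0 ≤ R := by linarith
  have hp1 : ∀ u, (p u).1 ∈ Set.Icc 0 R := fun u => (hp u).1
  have hNpos : ∀ j ≤ J, 0 < N j := by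
    intro j hj
    have h1 := hN j hj
    have h2 := Real.exp_pos (R / 2 - (h₀ + j))
    have : (0 : ℝ) < N j := by linarith
    exact_mod_cast this
  have hN0 := hNpos 0 (Nat.zero_le _)
  -- If `v` is not yet at the next level, its radius exceeds that level by at most `1`, so the node
  -- in the cell of the next layer in its own sector is a neighbour.
  have hladder : ∀ j < J, ∀ v, (p v).1 ≤ R - (h₀ + j) →
      (p v).1 ≤ R - (h₀ + (j + 1 : ℕ)) ∨
        ∃ u, (graph n C p).Adj v u ∧ (p u).1 ≤ R - (h₀ + (j + 1 : ℕ)) := by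
    intro j hj v hv
    by_cases hle : (p v).1 ≤ R - (h₀ + (j + 1 : ℕ))
    · exact Or.inl hle
    right
    push Not at hle
    obtain ⟨i, hi, hvi⟩ := exists_mem_sector (hNpos (j + 1) hj) (hp v).2
    obtain ⟨u, hu⟩ := hcell (j + 1) hj i hi
    refine ⟨u, ?_, hu.1.2⟩
    rw [graph_adj_iff (hp1 v).1 (hp1 u).1 hR0]
    refine ⟨?_, ?_⟩
    · rintro rfl
      exact absurd hu.1.2 (not_le.2 hle)
    · refine coshDist_le_of_mem_sector (h := h₀ + (j + 1 : ℕ)) hR (hp1 v).1 (hp1 u).1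
        ⟨hle.le, ?_⟩ hu.1 (hN (j + 1) hj) hvi hu.2
      push_cast
      linarith
  have hinner := SimpleGraph.exists_walk_of_ladder (G := graph n C p)
    (fun j v => (p v).1 ≤ R - (h₀ + j)) J hladder
  have hcellZ : ∀ i : ℤ, ∃ u, ∃ m : ℤ, (p u).1 ≤ R - (h₀ + (0 : ℕ)) ∧
      (p u).2 + 2 * Real.pi * m ∈ sector (N 0) i := by
    intro i
    have hNz : (N 0 : ℤ) ≠ 0 := by exact_mod_cast hN0.ne'
    have h1 := Int.emod_nonneg i hNz
    have h2 := Int.emod_lt_of_pos i (by exact_mod_cast hN0 : (0 : ℤ) < N 0)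
    obtain ⟨u, hu⟩ := hcell 0 (Nat.zero_le _) (i % N 0).toNat (by omega)
    refine ⟨u, i / N 0, hu.1.2, ?_⟩
    rw [add_mem_sector_iff hN0]
    have h3 : i - i / N 0 * N 0 = ((i % N 0).toNat : ℤ) := by
      have := Int.emod_add_mul_ediv i (N 0)
      rw [Int.toNat_of_nonneg h1]
      linarith
    rw [h3]; exact hu.2
  have hcrowd : ∀ i : ℤ, ((Finset.univ.filter fun u => ∃ m : ℤ,
      (p u).2 + 2 * Real.pi * m ∈ sector (N 0) i).card) ≤ M := by
    intro i
    have hNz : (N 0 : ℤ) ≠ 0 := by exact_mod_cast hN0.ne'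
    have h1 := Int.emod_nonneg i hNz
    have h2 := Int.emod_lt_of_pos i (by exact_mod_cast hN0 : (0 : ℤ) < N 0)
    refine hM (i % N 0).toNat (by omega) _ ?_
    intro u hu
    obtain ⟨m, hm⟩ := (Finset.mem_filter.1 hu).2
    rw [add_mem_sector_iff hN0] at hm
    obtain ⟨k, hk, hk'⟩ := exists_mem_sector hN0 (hp u).2
    have heq : i - m * N 0 = k := by
      rw [mem_sector_iff hN0] at hm hk'
      exact hm.symm.trans hk'
    have : i % N 0 = k := by
      have : i = k + m * N 0 := by linarith
      rw [this, Int.add_mul_emod_self_right]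
      exact Int.emod_eq_of_lt (by omega) (by omega)
    rw [this]
    simpa using hk'
  refine SimpleGraph.ConnectedComponent.diam_toSimpleGraph_le _ (fun u v huv => ?_) K
  -- `3M` steps inside the arc, one edge to depth `h₀`, then `J` steps inwards to the clique.
  refine SimpleGraph.exists_walk_length_le_of_clique_or_small
    {v | (p v).1 ≤ R - (h₀ + J)} (3 * M + 1 + J) (3 * M) ?_ ?_ (by omega) huv
  · intro x hx y hy hxy
    rw [graph_adj_iff (hp1 x).1 (hp1 y).1 hR0]
    refine ⟨hxy, coshDist_le_of_add_le (hp1 x).1 (hp1 y).1 (Real.neg_one_le_cos _) ?_⟩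
    simp only [Set.mem_ofPred_eq] at hx hy
    linarith
  · intro v
    set ρ := R - (h₀ + (0 : ℕ)) with hρ
    by_cases hv : (p v).1 ≤ ρ
    · obtain ⟨c, hc, w, hw⟩ := hinner v hv
      exact Or.inl ⟨c, hc, w, by omega⟩
    push Not at hv
    obtain ⟨k, hk, hvk⟩ := exists_mem_sector hN0 (hp v).2
    obtain ⟨a, ma, ha, hma⟩ := hcellZ (k - 1)
    obtain ⟨b, mb, hb, hmb⟩ := hcellZ (k + 1)
    set T := Finset.univ.filter fun u => ∃ m : ℤ, (p u).2 + 2 * Real.pi * m ∈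
      Set.Icc ((p a).2 + 2 * Real.pi * ma) ((p b).2 + 2 * Real.pi * mb) with hT
    set D : Set (Fin n) := {u | (p u).1 ≤ ρ ∨ ∃ w, (p w).1 ≤ ρ ∧ (graph n C p).Adj u w} with hD
    have hTcard : T.card ≤ 3 * M := by
      have hsub : T ⊆ (Finset.univ.filter fun u => ∃ m : ℤ,
            (p u).2 + 2 * Real.pi * m ∈ sector (N 0) (k - 1)) ∪
          (Finset.univ.filter fun u => ∃ m : ℤ,
            (p u).2 + 2 * Real.pi * m ∈ sector (N 0) k) ∪
          (Finset.univ.filter fun u => ∃ m : ℤ,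
            (p u).2 + 2 * Real.pi * m ∈ sector (N 0) (k + 1)) := by
        intro u hu
        obtain ⟨m, hm⟩ := (Finset.mem_filter.1 hu).2
        have hNr : (0 : ℝ) < N 0 := by exact_mod_cast hN0
        have hpi := Real.two_pi_pos
        set x := (p u).2 + 2 * Real.pi * m with hx
        have hl : (k : ℤ) - 1 ≤ ⌊x * N 0 / (2 * Real.pi)⌋ := by
          rw [mem_sector_iff hN0] at hma
          rw [← hma]
          exact Int.floor_le_floor (by have := hm.1; gcongr)
        have hr : ⌊x * N 0 / (2 * Real.pi)⌋ ≤ (k : ℤ) + 1 := by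
          rw [mem_sector_iff hN0] at hmb
          rw [← hmb]
          exact Int.floor_le_floor (by have := hm.2; gcongr)
        simp only [Finset.mem_union, Finset.mem_filter, Finset.mem_univ, true_and]
        rcases (by omega : ⌊x * N 0 / (2 * Real.pi)⌋ = (k : ℤ) - 1 ∨
          ⌊x * N 0 / (2 * Real.pi)⌋ = (k : ℤ) ∨ ⌊x * N 0 / (2 * Real.pi)⌋ = (k : ℤ) + 1)
          with h | h | h
        · exact Or.inl (Or.inl ⟨m, (mem_sector_iff hN0).2 h⟩)
        · exact Or.inl (Or.inr ⟨m, (mem_sector_iff hN0).2 h⟩)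
        · exact Or.inr ⟨m, (mem_sector_iff hN0).2 h⟩
      refine (Finset.card_le_card hsub).trans ((Finset.card_union_le _ _).trans ?_)
      have h1 := Finset.card_union_le (Finset.univ.filter fun u => ∃ m : ℤ,
            (p u).2 + 2 * Real.pi * m ∈ sector (N 0) (k - 1)) (Finset.univ.filter fun u => ∃ m : ℤ,
            (p u).2 + 2 * Real.pi * m ∈ sector (N 0) k)
      have := hcrowd (k - 1)
      have := hcrowd k
      have := hcrowd (k + 1)
      omega
    have hvT : v ∈ T := by
      refine Finset.mem_filter.2 ⟨Finset.mem_univ _, 0, ?_⟩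
      have h1 := hma.2
      have h2 := hmb.1
      have h3 := hvk.1
      have h4 := hvk.2
      push_cast at h1 h2 h3 h4 ⊢
      rw [sub_add_cancel] at h1
      constructor <;> linarith
    have hclosed : ∀ u ∈ T, u ∉ D → ∀ u', (graph n C p).Adj u u' → u' ∈ T := by
      intro u hu huD u' hadj
      obtain ⟨m, hm⟩ := (Finset.mem_filter.1 hu).2
      simp only [hD, Set.mem_ofPred_eq, not_or, not_exists, not_and] at huD
      exact Finset.mem_filter.2 ⟨Finset.mem_univ _,
        adj_mem_arc hR0 hp1 ha hb (not_le.1 huD.1) huD.2 hm hadj⟩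
    rcases SimpleGraph.exists_walk_length_le_card_or_reachable_subset T D hclosed hvT with
      ⟨d, hd, w, hw⟩ | h
    · left
      rcases hd with hd | ⟨e, he, hadj⟩
      · obtain ⟨c, hc, q, hq⟩ := hinner d hd
        exact ⟨c, hc, w.append q, by simp; omega⟩
      · obtain ⟨c, hc, q, hq⟩ := hinner e he
        exact ⟨c, hc, (w.concat hadj).append q, by simp; omega⟩
    · exact Or.inr ⟨T, hTcard, h⟩

end HyperbolicRandomGraph

/-! ### Occupancy of sets by independent nodes. -/

namespace HyperbolicRandomGraph

section Occupancy

variable {E : Type*} [MeasurableSpace E] {μ : Measure E} [IsProbabilityMeasure μ]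

theorem pi_forall_notMem_le (n : ℕ) {S : Set E} (hS : MeasurableSet S) :
    Measure.pi (fun _ : Fin n => μ) {p | ∀ u, p u ∉ S}
      ≤ ENNReal.ofReal (Real.exp (-(n * μ.real S))) := by
  have h1 : {p : Fin n → E | ∀ u, p u ∉ S} = Set.univ.pi fun _ => Sᶜ := by
    ext p; simp
  have h2 : μ Sᶜ = ENNReal.ofReal (1 - μ.real S) := by
    rw [← probReal_compl_eq_one_sub hS, ofReal_measureReal]
  have h3 : 0 ≤ 1 - μ.real S := sub_nonneg.2 measureReal_le_one
  rw [h1, Measure.pi_pi, Finset.prod_const, Finset.card_univ, Fintype.card_fin, h2,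
    ← ENNReal.ofReal_pow h3]
  refine ENNReal.ofReal_le_ofReal ?_
  have h4 : 1 - μ.real S ≤ Real.exp (-μ.real S) := by
    have := Real.add_one_le_exp (-μ.real S); linarith
  calc (1 - μ.real S) ^ n ≤ Real.exp (-μ.real S) ^ n := pow_le_pow_left₀ h3 h4 n
    _ = Real.exp (-(n * μ.real S)) := by rw [← Real.exp_nat_mul]; ring_nf

/-- Chernoff bound with exponent `1`: the product of the `f (p u)` is `exp` of the number of nodes
in `S`. Its mean is `(1 + (e - 1) μ S) ^ n ≤ exp(2 n μ S)`, as `e - 1 ≤ 2`, and Markov's inequality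
finishes. -/
theorem pi_le_card_filter_le (n : ℕ) {S : Set E} (hS : MeasurableSet S) (t : ℝ) :
    Measure.pi (fun _ : Fin n => μ)
        {p | ∃ T : Finset (Fin n), (∀ u ∈ T, p u ∈ S) ∧ t ≤ T.card}
      ≤ ENNReal.ofReal (Real.exp (2 * (n * μ.real S) - t)) := by
  classical
  set f : E → ℝ := fun x => 1 + S.indicator (fun _ => Real.exp 1 - 1) x with hf
  have he : 1 ≤ Real.exp 1 := Real.one_le_exp (by norm_num)
  have hf1 : ∀ x, 1 ≤ f x := by
    intro x
    have : 0 ≤ S.indicator (fun _ => Real.exp 1 - 1) x :=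
      Set.indicator_nonneg (fun _ _ => by linarith) x
    simp only [hf]; linarith
  have hfS : ∀ x ∈ S, f x = Real.exp 1 := by
    intro x hx; simp [hf, hx]
  have hind : Integrable (S.indicator fun _ : E => Real.exp 1 - 1) μ :=
    (integrable_const _).indicator hS
  have hfi : Integrable f μ := (integrable_const 1).add hind
  have hint : ∫ x, f x ∂μ = 1 + (Real.exp 1 - 1) * μ.real S := by
    simp only [hf]
    rw [integral_add (integrable_const 1) hind, integral_indicator hS]
    simp [mul_comm]
  have hprod : ∫ p : Fin n → E, ∏ u, f (p u) ∂(Measure.pi fun _ => μ)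
      = (∫ x, f x ∂μ) ^ n := by
    simpa using integral_fintype_prod_eq_pow (ι := Fin n) (μ := μ) f
  have hprodi : Integrable (fun p : Fin n → E => ∏ u, f (p u)) (Measure.pi fun _ => μ) :=
    Integrable.fintype_prod fun _ => hfi
  have hsub : {p : Fin n → E | ∃ T : Finset (Fin n), (∀ u ∈ T, p u ∈ S) ∧ t ≤ T.card}
      ⊆ {p | Real.exp t ≤ ∏ u, f (p u)} := by
    rintro p ⟨T, hT, hcard⟩
    calc Real.exp t ≤ Real.exp (T.card) := Real.exp_le_exp.2 hcard
      _ = ∏ u ∈ T, f (p u) := by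
        rw [Finset.prod_congr rfl fun u hu => hfS _ (hT u hu), Finset.prod_const,
          ← Real.exp_nat_mul, mul_one]
      _ ≤ ∏ u, f (p u) := by
        rw [← Finset.prod_ite_mem_eq T]
        refine Finset.prod_le_prod (fun u _ => ?_) fun u _ => ?_
        · split_ifs
          exacts [zero_le_one.trans (hf1 _), zero_le_one]
        · split_ifs
          exacts [le_rfl, hf1 _]
  have hmarkov := mul_meas_ge_le_integral_of_nonneg (μ := Measure.pi fun _ : Fin n => μ)
    (f := fun p => ∏ u, f (p u))
    (Filter.Eventually.of_forall fun p => Finset.prod_nonneg fun u _ => zero_le_one.trans (hf1 _))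
    hprodi (Real.exp t)
  rw [hprod, hint] at hmarkov
  refine (measure_mono hsub).trans ?_
  rw [← ofReal_measureReal]
  refine ENNReal.ofReal_le_ofReal ?_
  rw [Real.exp_sub, le_div_iff₀ (Real.exp_pos t), mul_comm]
  refine hmarkov.trans ?_
  have h0 : 0 ≤ μ.real S := measureReal_nonneg
  have h3 : 1 + (Real.exp 1 - 1) * μ.real S ≤ Real.exp (2 * μ.real S) := by
    have h4 := Real.add_one_le_exp (2 * μ.real S)
    have h5 := Real.exp_one_lt_d9
    nlinarith
  calc (1 + (Real.exp 1 - 1) * μ.real S) ^ n ≤ Real.exp (2 * μ.real S) ^ n :=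
        pow_le_pow_left₀ (by nlinarith) h3 n
    _ = Real.exp (2 * (n * μ.real S)) := by rw [← Real.exp_nat_mul]; ring_nf

end Occupancy

/-! ### Masses of cells and sectors under the node law. -/

theorem integral_radialDensity {α R : ℝ} (hα : 0 < α) (hR : 0 < R) :
    ∫ r in (0)..R, radialDensity α R r = 1 := by
  have h1 : 1 < Real.cosh (α * R) := Real.one_lt_cosh.2 (by positivity)
  have hd : ∀ x ∈ Set.uIcc 0 R, HasDerivAt (fun r => Real.cosh (α * r) / (Real.cosh (α * R) - 1))
      (radialDensity α R x) x := by
    intro x _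
    have h2 := ((hasDerivAt_id x).const_mul α).cosh.div_const (Real.cosh (α * R) - 1)
    exact h2.congr_deriv (by simp only [radialDensity, id]; ring)
  rw [intervalIntegral.integral_eq_sub_of_hasDerivAt hd]
  · rw [← sub_div]
    simp only [mul_zero, Real.cosh_zero]
    exact div_self (by linarith)
  · refine Continuous.intervalIntegrable ?_ _ _
    unfold radialDensity
    fun_prop

theorem radialDensity_nonneg {α R r : ℝ} (hα : 0 ≤ α) (hr : 0 ≤ r) :
    0 ≤ radialDensity α R r := by
  have h1 := Real.one_le_cosh (α * R)
  exact div_nonneg (mul_nonneg hα (Real.sinh_nonneg_iff.2 (by positivity))) (by linarith)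

theorem isProbabilityMeasure_radialLaw {α R : ℝ} (hα : 0 < α) (hR : 0 < R) :
    IsProbabilityMeasure (radialLaw α R) := by
  constructor
  rw [radialLaw, withDensity_apply _ MeasurableSet.univ, Measure.restrict_univ,
    ← ofReal_integral_eq_lintegral_ofReal, integral_Icc_eq_integral_Ioc,
    ← intervalIntegral.integral_of_le hR.le, integral_radialDensity hα hR, ENNReal.ofReal_one]
  · refine Continuous.integrableOn_Icc ?_
    unfold radialDensity
    fun_prop
  · filter_upwards [ae_restrict_mem measurableSet_Icc] with r hr
    exact radialDensity_nonneg hα.le hr.1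

theorem radialLaw_compl_Icc (α R : ℝ) : radialLaw α R (Set.Icc 0 R)ᶜ = 0 := by
  rw [radialLaw, withDensity_apply _ measurableSet_Icc.compl,
    Measure.restrict_restrict measurableSet_Icc.compl]
  simp

/-- The denominator is at most `exp(α R)`, and `sinh(α r) ≥ exp(α r) / 4` as soon as `α r ≥ 1`. -/
theorem le_radialDensity {α R r h : ℝ} (hα : 0 < α) (hr : R - h - 1 ≤ r)
    (hrR : 1 ≤ α * (R - h - 1)) (hh : 0 ≤ h) :
    α / 4 * Real.exp (-α) * Real.exp (-(α * h)) ≤ radialDensity α R r := by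
  have hR : R - h - 1 ≤ R := by linarith
  have h0 : 1 ≤ α * R := hrR.trans (by gcongr)
  have h1 : 1 < Real.cosh (α * R) := Real.one_lt_cosh.2 (by positivity)
  have h2 : Real.cosh (α * R) - 1 ≤ Real.exp (α * R) := by
    rw [Real.cosh_eq]
    have : Real.exp (-(α * R)) ≤ Real.exp (α * R) := Real.exp_le_exp.2 (by linarith)
    linarith
  have h3 : 1 ≤ α * r := hrR.trans (by gcongr)
  have h4 : Real.exp (α * (R - h - 1)) / 4 ≤ Real.sinh (α * r) := by
    have h5 : Real.exp (α * (R - h - 1)) ≤ Real.exp (α * r) := Real.exp_le_exp.2 (by gcongr)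
    have h6 : Real.exp (-(α * r)) * 2 ≤ Real.exp (α * r) := by
      have h7 : Real.exp (α * r) = Real.exp (-(α * r)) * Real.exp (2 * (α * r)) := by
        rw [← Real.exp_add]; ring_nf
      have h8 := Real.add_one_le_exp (2 * (α * r))
      rw [h7]
      gcongr
      linarith
    rw [Real.sinh_eq]; linarith
  unfold radialDensity
  rw [le_div_iff₀ (by linarith)]
  calc α / 4 * Real.exp (-α) * Real.exp (-(α * h)) * (Real.cosh (α * R) - 1)
      ≤ α / 4 * Real.exp (-α) * Real.exp (-(α * h)) * Real.exp (α * R) := by gcongr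
    _ = α * (Real.exp (α * (R - h - 1)) / 4) := by
      have : Real.exp (α * (R - h - 1))
          = Real.exp (-α) * Real.exp (-(α * h)) * Real.exp (α * R) := by
        rw [← Real.exp_add, ← Real.exp_add]; ring_nf
      rw [this]; ring
    _ ≤ α * Real.sinh (α * r) := by gcongr

theorem le_radialLaw_Icc {α R h : ℝ} (hα : 0 < α) (hrR : 1 ≤ α * (R - h - 1)) (hh : 0 ≤ h) :
    ENNReal.ofReal (α / 4 * Real.exp (-α) * Real.exp (-(α * h)))
      ≤ radialLaw α R (Set.Icc (R - h - 1) (R - h)) := by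
  have hpos : 0 < R - h - 1 := by
    by_contra! hc
    nlinarith
  rw [radialLaw, withDensity_apply _ measurableSet_Icc,
    Measure.restrict_restrict measurableSet_Icc,
    Set.inter_eq_left.2 (Set.Icc_subset_Icc hpos.le (by linarith))]
  calc ENNReal.ofReal (α / 4 * Real.exp (-α) * Real.exp (-(α * h)))
      = ∫⁻ _ in Set.Icc (R - h - 1) (R - h),
          ENNReal.ofReal (α / 4 * Real.exp (-α) * Real.exp (-(α * h))) := by
        rw [setLIntegral_const, Real.volume_Icc]
        norm_num
    _ ≤ _ := setLIntegral_mono' measurableSet_Icc fun r hr =>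
        ENNReal.ofReal_le_ofReal (le_radialDensity hα hr.1 hrR hh)

theorem volume_Ico_two_pi : volume (Set.Ico 0 (2 * Real.pi)) = ENNReal.ofReal (2 * Real.pi) := by
  rw [Real.volume_Ico, sub_zero]

instance isProbabilityMeasure_angularLaw : IsProbabilityMeasure angularLaw := by
  refine ProbabilityTheory.cond_isProbabilityMeasure_of_finite ?_ ?_
  · rw [volume_Ico_two_pi]; simp [Real.pi_pos]
  · rw [volume_Ico_two_pi]; exact ENNReal.ofReal_ne_top

theorem measurableSet_sector (N : ℕ) (i : ℤ) : MeasurableSet (sector N i) := measurableSet_Ico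

theorem angularLaw_sector {N i : ℕ} (hi : i < N) :
    angularLaw (sector N i) = ENNReal.ofReal (1 / N) := by
  have hN : (0 : ℝ) < N := by exact_mod_cast (Nat.zero_le i).trans_lt hi
  have hpi := Real.two_pi_pos
  have hsub : sector N i ⊆ Set.Ico 0 (2 * Real.pi) := by
    refine Set.Ico_subset_Ico (by positivity) ?_
    have : ((i : ℝ) + 1) / N ≤ 1 := by
      rw [div_le_one hN]; exact_mod_cast hi
    push_cast
    nlinarith
  rw [angularLaw, ProbabilityTheory.cond_apply measurableSet_Ico, Set.inter_eq_right.2 hsub,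
    volume_Ico_two_pi, sector, Real.volume_Ico, ← ENNReal.ofReal_inv_of_pos hpi,
    ← ENNReal.ofReal_mul (by positivity)]
  congr 1
  push_cast
  field_simp
  ring

theorem angularLaw_compl_Ico : angularLaw (Set.Ico 0 (2 * Real.pi))ᶜ = 0 := by
  rw [angularLaw, ProbabilityTheory.cond_apply measurableSet_Ico]
  simp

theorem nodeLaw_compl_eq_zero {α R : ℝ} (hα : 0 < α) (hR : 0 < R) :
    nodeLaw α R (Set.Icc 0 R ×ˢ Set.Ico 0 (2 * Real.pi))ᶜ = 0 := by
  have := isProbabilityMeasure_radialLaw hα hR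
  rw [Set.compl_prod_eq_union, nodeLaw]
  refine measure_union_null ?_ ?_
  · rw [Measure.prod_prod, radialLaw_compl_Icc, zero_mul]
  · rw [Measure.prod_prod, angularLaw_compl_Ico, mul_zero]

theorem le_nodeLaw_cell {α R h : ℝ} {N i : ℕ} (hα : 0 < α) (hrR : 1 ≤ α * (R - h - 1))
    (hh : 0 ≤ h) (hi : i < N) :
    α / 4 * Real.exp (-α) * Real.exp (-(α * h)) * (1 / N)
      ≤ (nodeLaw α R).real (Set.Icc (R - h - 1) (R - h) ×ˢ sector N i) := by
  have hR : 0 < R := by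
    by_contra! hc
    nlinarith
  have := isProbabilityMeasure_radialLaw hα hR
  rw [nodeLaw, measureReal_prod_prod]
  refine mul_le_mul ?_ ?_ (by positivity) measureReal_nonneg
  · exact (ENNReal.ofReal_le_iff_le_toReal (measure_ne_top _ _)).1 (le_radialLaw_Icc hα hrR hh)
  · rw [Measure.real, angularLaw_sector hi, ENNReal.toReal_ofReal (by positivity)]

theorem nodeLaw_sector {α R : ℝ} {N i : ℕ} (hα : 0 < α) (hR : 0 < R) (hi : i < N) :
    (nodeLaw α R).real (Set.univ ×ˢ sector N i) = 1 / N := by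
  have := isProbabilityMeasure_radialLaw hα hR
  rw [nodeLaw, measureReal_prod_prod, probReal_univ, one_mul, Measure.real, angularLaw_sector hi,
    ENNReal.toReal_ofReal (by positivity)]

end HyperbolicRandomGraph

/-! ### Union bound and choice of the depth `h₀`. -/

namespace HyperbolicRandomGraph

theorem nodesLaw_exists_notMem_eq_zero {n : ℕ} {α C : ℝ} (hα : 0 < α)
    (hR : 0 < discRadius n C) :
    nodesLaw n α C
      {p | ∃ u, p u ∉ Set.Icc 0 (discRadius n C) ×ˢ Set.Ico 0 (2 * Real.pi)} = 0 := by
  have := isProbabilityMeasure_radialLaw hα hR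
  have : IsProbabilityMeasure (nodeLaw α (discRadius n C)) := by unfold nodeLaw; infer_instance
  have h : {p : Fin n → ℝ × ℝ |
      ∃ u, p u ∉ Set.Icc 0 (discRadius n C) ×ˢ Set.Ico 0 (2 * Real.pi)} =
      ⋃ u, Function.eval u ⁻¹' (Set.Icc 0 (discRadius n C) ×ˢ Set.Ico 0 (2 * Real.pi))ᶜ := by
    ext p; simp only [Set.mem_iUnion]; rfl
  rw [h, measure_iUnion_null_iff]
  intro u
  exact Measure.pi_eval_preimage_null _ (nodeLaw_compl_eq_zero hα hR)

/-- The number of sectors of a layer at depth `h`. -/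
noncomputable def sectorCount (R h : ℝ) : ℕ := ⌈8 * Real.exp (R / 2 - h)⌉₊

theorem sectorCount_le {R h : ℝ} (h' : h ≤ R / 2 + 1) :
    (sectorCount R h : ℝ) ≤ 11 * Real.exp (R / 2 - h) := by
  have h1 : (sectorCount R h : ℝ) < 8 * Real.exp (R / 2 - h) + 1 :=
    Nat.ceil_lt_add_one (by positivity)
  -- The `+ 1` from rounding up is absorbed by raising `8` to `11`.
  have h2 : 1 ≤ 3 * Real.exp (R / 2 - h) := by
    have h3 : Real.exp 1 * Real.exp (R / 2 - h) = Real.exp (1 + (R / 2 - h)) :=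
      (Real.exp_add _ _).symm
    have h4 : 1 ≤ Real.exp (1 + (R / 2 - h)) := Real.one_le_exp (by linarith)
    have h5 := Real.exp_one_lt_d9
    have h6 := Real.exp_pos (R / 2 - h)
    nlinarith
  linarith

theorem exp_half_discRadius {n : ℕ} (hn : 0 < n) (C : ℝ) :
    Real.exp (discRadius n C / 2) = n * Real.exp (C / 2) := by
  have : (0 : ℝ) < n := by exact_mod_cast hn
  rw [discRadius, add_div, Real.exp_add, mul_div_cancel_left₀ _ (two_ne_zero), Real.exp_log this]

/-- The expected number of nodes in a cell of the layer at depth `h` is at least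
`cellConst α C * exp ((1 - α) * h)`. -/
noncomputable def cellConst (α C : ℝ) : ℝ := α / 4 * Real.exp (-α) / (11 * Real.exp (C / 2))

/-- A cell has mass of order `exp(-α h) / N` with `N` of order at most `n exp(-h)`. Since `α < 1`,
deeper cells are fuller, so the outermost layer is the critical one. -/
theorem le_expected_cell {n i : ℕ} {α C h : ℝ} (hn : 0 < n) (hα : 0 < α)
    (hrR : 1 ≤ α * (discRadius n C - h - 1)) (hh : 0 ≤ h) (hh' : h ≤ discRadius n C / 2 + 1)
    (hi : i < sectorCount (discRadius n C) h) :
    cellConst α C * Real.exp ((1 - α) * h) ≤ n * (nodeLaw α (discRadius n C)).real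
      (Set.Icc (discRadius n C - h - 1) (discRadius n C - h) ×ˢ
        sector (sectorCount (discRadius n C) h) i) := by
  have hn' : (0 : ℝ) < n := by exact_mod_cast hn
  have hN : (0 : ℝ) < sectorCount (discRadius n C) h := by
    exact_mod_cast (Nat.zero_le i).trans_lt hi
  have h1 := le_nodeLaw_cell hα hrR hh hi
  have h2 := sectorCount_le hh'
  have h3 : Real.exp (discRadius n C / 2 - h) = n * Real.exp (C / 2) * Real.exp (-h) := by
    rw [sub_eq_add_neg, Real.exp_add, exp_half_discRadius hn]
  rw [h3] at h2
  have h4 : Real.exp ((1 - α) * h) = Real.exp (-(α * h)) / Real.exp (-h) := by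
    rw [← Real.exp_sub]; ring_nf
  calc cellConst α C * Real.exp ((1 - α) * h)
      = n * (α / 4 * Real.exp (-α) * Real.exp (-(α * h)) *
          (1 / (11 * (n * Real.exp (C / 2) * Real.exp (-h))))) := by
        rw [h4, cellConst]; field_simp
    _ ≤ n * (α / 4 * Real.exp (-α) * Real.exp (-(α * h)) *
          (1 / sectorCount (discRadius n C) h)) := by gcongr
    _ ≤ _ := by gcongr

/-- Union bound over a null event (`E₁`), the empty cells (`E₂`) and the crowded sectors of layer
`0` (`E₃`). By `hdepth` and `hM` each single cell or sector fails with probability at most `exp(-4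
log n)`, and layer `0` has the most sectors. -/
theorem nodesLaw_diam_le {n : ℕ} {α C h₀ : ℝ} {J M : ℕ} (hn : 0 < n) (hα : 0 < α) (hα' : α < 1)
    (hR : 4 ≤ discRadius n C) (hRα : 1 ≤ α * (discRadius n C / 2 - 2)) (hh₀ : 0 ≤ h₀)
    (hdepth : 4 * Real.log n ≤ cellConst α C * Real.exp ((1 - α) * h₀))
    (hJ : discRadius n C / 2 ≤ h₀ + J) (hJ' : h₀ + J ≤ discRadius n C / 2 + 1)
    (hM : 2 * (n * (1 / sectorCount (discRadius n C) h₀)) + 4 * Real.log n ≤ M + 1) :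
    nodesLaw n α C {p | ¬ ∀ K : (graph n C p).ConnectedComponent,
        K.toSimpleGraph.diam ≤ 2 * (3 * M + 1 + J) + 1}
      ≤ ENNReal.ofReal ((J + 2) * sectorCount (discRadius n C) h₀
          * Real.exp (-(4 * Real.log n))) := by
  set R := discRadius n C with hRdef
  have hR0 : 0 < R := by linarith
  have := isProbabilityMeasure_radialLaw hα hR0
  have : IsProbabilityMeasure (nodeLaw α R) := by unfold nodeLaw; infer_instance
  set N : ℕ → ℕ := fun j => sectorCount R (h₀ + j) with hNdef
  set ε := Real.exp (-(4 * Real.log n)) with hε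
  have hε0 : 0 ≤ ε := (Real.exp_pos _).le
  have hN0 : N 0 = sectorCount R h₀ := by simp [hNdef]
  have hNle : ∀ j, N j ≤ N 0 := by
    intro j
    refine Nat.ceil_mono ?_
    have : (0 : ℝ) ≤ j := Nat.cast_nonneg j
    gcongr
    linarith
  set E₁ : Set (Fin n → ℝ × ℝ) := {p | ∃ u, p u ∉ Set.Icc 0 R ×ˢ Set.Ico 0 (2 * Real.pi)}
  set E₂ : ℕ → ℕ → Set (Fin n → ℝ × ℝ) := fun j i =>
    {p | ∀ u, p u ∉ Set.Icc (R - (h₀ + j) - 1) (R - (h₀ + j)) ×ˢ sector (N j) i} with hE₂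
  set E₃ : ℕ → Set (Fin n → ℝ × ℝ) := fun i =>
    {p | ∃ T : Finset (Fin n), (∀ u ∈ T, p u ∈ (Set.univ : Set ℝ) ×ˢ sector (N 0) i) ∧
      ((M : ℝ) + 1) ≤ T.card} with hE₃
  have hsub : {p | ¬ ∀ K : (graph n C p).ConnectedComponent,
        K.toSimpleGraph.diam ≤ 2 * (3 * M + 1 + J) + 1} ⊆
      E₁ ∪ ((⋃ j ∈ Finset.range (J + 1), ⋃ i ∈ Finset.range (N j), E₂ j i) ∪
        ⋃ i ∈ Finset.range (N 0), E₃ i) := by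
    intro p hp
    by_contra hnot
    apply hp
    simp only [Set.mem_union, Set.mem_iUnion, not_or, not_exists, Finset.mem_range] at hnot
    obtain ⟨h1, h2, h3⟩ := hnot
    refine diam_le_of_cells J M N hR ?_ (fun j _ => Nat.le_ceil _) hJ ?_ ?_
    · intro u
      by_contra h
      exact h1 ⟨u, h⟩
    · intro j hj i hi
      by_contra! h
      exact h2 j (by omega) i hi h
    · intro i hi T hT
      by_contra! h
      exact h3 i hi ⟨T, fun u hu => ⟨trivial, hT u hu⟩, by exact_mod_cast h⟩
  have hP₂ : ∀ j < J + 1, ∀ i < N j, nodesLaw n α C (E₂ j i) ≤ ENNReal.ofReal ε := by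
    intro j hj i hi
    have hjJ : (j : ℝ) ≤ J := by exact_mod_cast Nat.lt_succ_iff.1 hj
    have hj0 : (0 : ℝ) ≤ j := Nat.cast_nonneg j
    refine (pi_forall_notMem_le n (measurableSet_Icc.prod (measurableSet_sector _ _))).trans ?_
    refine ENNReal.ofReal_le_ofReal (Real.exp_le_exp.2 (neg_le_neg ?_))
    refine (hdepth.trans ?_).trans (le_expected_cell hn hα ?_ (by linarith) (by linarith) hi)
    · have : 0 ≤ cellConst α C := by unfold cellConst; positivity
      have : 0 ≤ 1 - α := by linarith
      gcongr
      linarith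
    · refine hRα.trans (mul_le_mul_of_nonneg_left ?_ hα.le)
      linarith
  have hP₃ : ∀ i < N 0, nodesLaw n α C (E₃ i) ≤ ENNReal.ofReal ε := by
    intro i hi
    refine (pi_le_card_filter_le n (MeasurableSet.univ.prod (measurableSet_sector _ _)) _).trans ?_
    rw [nodeLaw_sector hα hR0 hi]
    refine ENNReal.ofReal_le_ofReal (Real.exp_le_exp.2 ?_)
    rw [hN0]
    linarith
  have hS₂ : nodesLaw n α C (⋃ j ∈ Finset.range (J + 1), ⋃ i ∈ Finset.range (N j), E₂ j i)
      ≤ ((J + 1 : ℕ) : ENNReal) * ((N 0 : ENNReal) * ENNReal.ofReal ε) := by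
    refine (measure_biUnion_finset_le _ _).trans ?_
    refine (Finset.sum_le_card_nsmul _ _ ((N 0 : ENNReal) * ENNReal.ofReal ε) ?_).trans_eq
      (by rw [Finset.card_range, nsmul_eq_mul])
    intro j hj
    refine (measure_biUnion_finset_le _ _).trans ?_
    refine (Finset.sum_le_card_nsmul _ _ (ENNReal.ofReal ε) fun i hi =>
      hP₂ j (Finset.mem_range.1 hj) i (Finset.mem_range.1 hi)).trans ?_
    rw [Finset.card_range, nsmul_eq_mul]
    gcongr
    exact hNle j
  have hS₃ : nodesLaw n α C (⋃ i ∈ Finset.range (N 0), E₃ i)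
      ≤ (N 0 : ENNReal) * ENNReal.ofReal ε := by
    refine (measure_biUnion_finset_le _ _).trans ?_
    refine (Finset.sum_le_card_nsmul _ _ (ENNReal.ofReal ε) fun i hi =>
      hP₃ i (Finset.mem_range.1 hi)).trans_eq ?_
    rw [Finset.card_range, nsmul_eq_mul]
  refine (measure_mono hsub).trans ((measure_union_le _ _).trans ?_)
  rw [nodesLaw_exists_notMem_eq_zero hα hR0, zero_add]
  refine (measure_union_le _ _).trans ((add_le_add hS₂ hS₃).trans_eq ?_)
  rw [← hN0, ← ENNReal.ofReal_natCast, ← ENNReal.ofReal_natCast,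
    ← ENNReal.ofReal_mul (by positivity), ← ENNReal.ofReal_mul (by positivity),
    ← ENNReal.ofReal_add (by positivity) (by positivity)]
  congr 1
  push_cast
  ring

open Filter in
-- Here `x` is `log n`, `2 * x + C` is `R`, and the quotient is `h₀`. The last bound, `h₀ ≤ R/2`,
-- holds because `log x = o(x)`.
theorem eventually_layer_conditions {α c : ℝ} (C : ℝ) (hα : 0 < α) (hα' : α < 1) (hc : 0 < c) :
    ∀ᶠ x : ℝ in atTop, 1 ≤ x ∧ 4 ≤ 2 * x + C ∧ 1 ≤ α * ((2 * x + C) / 2 - 2) ∧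
      0 ≤ Real.log (4 * x / c) / (1 - α) ∧
      Real.log (4 * x / c) / (1 - α) ≤ (2 * x + C) / 2 := by
  have h1α : 0 < 1 - α := by linarith
  have hlog : ∀ᶠ x : ℝ in atTop, Real.log x ≤ (1 - α) / 2 * x := by
    have := Real.isLittleO_log_id_atTop.bound (half_pos h1α)
    filter_upwards [this, eventually_ge_atTop 1] with x hx hx1
    simp only [id, Real.norm_eq_abs] at hx
    rw [abs_of_nonneg (zero_le_one.trans hx1)] at hx
    exact (le_abs_self _).trans hx
  filter_upwards [hlog, eventually_ge_atTop 1, eventually_ge_atTop ((4 - C) / 2),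
    eventually_ge_atTop (1 / α + 2 - C / 2), eventually_ge_atTop (c / 4),
    eventually_ge_atTop ((Real.log (4 / c) - (1 - α) * (C / 2)) / ((1 - α) / 2))]
    with x h1 h2 h3 h4 h5 h6
  have hx : 0 < x := by linarith
  refine ⟨h2, by linarith, ?_, ?_, ?_⟩
  · have : 1 / α ≤ (2 * x + C) / 2 - 2 := by linarith
    rw [div_le_iff₀ hα] at this
    linarith
  · refine div_nonneg (Real.log_nonneg ?_) h1α.le
    rw [le_div_iff₀ hc]; linarith
  · rw [div_le_iff₀ (by linarith)] at h6
    rw [div_le_iff₀ h1α]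
    have : 4 * x / c = x * (4 / c) := by ring
    rw [this, Real.log_mul hx.ne' (by positivity)]
    linarith

end HyperbolicRandomGraph

open HyperbolicRandomGraph in
theorem theorem1 (α β C : ℝ) (hαβ : β = 2 * α + 1) (hβ₂ : 2 < β) (hβ₃ : β < 3) :
    ∃ A > (0 : ℝ), ∃ B > (0 : ℝ), ∃ N : ℕ, ∀ n : ℕ, N ≤ n →
      HyperbolicRandomGraph.nodesLaw n α C
        {p | ¬ ∀ K : (HyperbolicRandomGraph.graph n C p).ConnectedComponent,
            HyperbolicRandomGraph.IsGiant K →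
              (K.toSimpleGraph.diam : ℝ) ≤ A * Real.log n ^ (2 / (3 - β))}
        ≤ ENNReal.ofReal (B * (n : ℝ) ^ (-(3 / 2) : ℝ)) := by
  have hα : 0 < α := by linarith
  have hα' : α < 1 := by linarith
  have h1α : 0 < 1 - α := by linarith
  have hexp : 2 / (3 - β) = 1 / (1 - α) := by
    rw [hαβ, div_eq_div_iff (by linarith) (by linarith)]; ring
  rw [hexp]
  set γ := 1 / (1 - α) with hγ
  have hγ1 : 1 ≤ γ := by rw [hγ, le_div_iff₀ h1α]; linarith
  set c := cellConst α C with hc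
  have hc0 : 0 < c := by rw [hc]; unfold cellConst; positivity
  -- Chosen so that `a * L ^ γ = exp h₀ / (4 exp(C/2))`, which bounds twice the mean number of nodes
  -- in a sector of layer `0`.
  set a := (4 / c) ^ γ / (4 * Real.exp (C / 2)) with ha
  have ha0 : 0 < a := by positivity
  have hev := (Real.tendsto_log_atTop.comp tendsto_natCast_atTop_atTop).eventually
    (eventually_layer_conditions C hα hα' hc0)
  obtain ⟨n₀, hn₀⟩ := Filter.eventually_atTop.1 hev
  -- From `M ≤ a L^γ + 4L` and `J ≤ L + |C|/2 + 1`, the diameter is at most `6a L^γ + 26L + |C| +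
  -- 5`, with `1 ≤ L ≤ L^γ`. The second constant multiplies `J + 2 ≤ (|C| + 4) n` and a sector count
  -- of at most `11 n exp(C/2)`.
  refine ⟨6 * a + 31 + |C|, by positivity, (|C| + 4) * (11 * Real.exp (C / 2)), by positivity,
    max n₀ 1, fun n hn => ?_⟩
  obtain ⟨hL1, hR4, hRα, hh0, hhR⟩ := hn₀ n ((le_max_left _ _).trans hn)
  have hn1 : 0 < n := (le_max_right _ _).trans hn
  have hn' : (1 : ℝ) ≤ n := by exact_mod_cast hn1
  simp only [Function.comp_apply] at hL1 hR4 hRα hh0 hhR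
  set L := Real.log n with hL
  have hRL : discRadius n C = 2 * L + C := rfl
  -- This depth solves `c * exp((1 - α) h₀) = 4 log n`.
  set h₀ := Real.log (4 * L / c) / (1 - α) with hh₀
  set R := discRadius n C with hR
  set J := ⌈R / 2 - h₀⌉₊ with hJdef
  have hJ1 : R / 2 ≤ h₀ + J := by
    have := Nat.le_ceil (R / 2 - h₀)
    linarith
  have hJ2 : h₀ + J ≤ R / 2 + 1 := by
    have : (J : ℝ) < R / 2 - h₀ + 1 := Nat.ceil_lt_add_one (by rw [hRL]; linarith)
    linarith
  set q : ℝ := 2 * (n * (1 / sectorCount R h₀)) + 4 * L with hq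
  have hq0 : 0 ≤ q := by positivity
  set M := ⌊q⌋₊ with hMdef
  have hM1 : q ≤ M + 1 := (Nat.lt_floor_add_one q).le
  have hM2 : (M : ℝ) ≤ q := Nat.floor_le hq0
  have hLpos : 0 < L := by linarith
  have hexp0 : Real.exp ((1 - α) * h₀) = 4 * L / c := by
    rw [hh₀, mul_div_cancel₀ _ h1α.ne', Real.exp_log (by positivity)]
  have hexph : Real.exp h₀ = (4 / c) ^ γ * L ^ γ := by
    rw [← Real.mul_rpow (by positivity) hLpos.le, Real.rpow_def_of_pos (by positivity), hγ, hh₀]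
    congr 1
    rw [mul_one_div, div_mul_eq_mul_div]
  have hmain := nodesLaw_diam_le (n := n) (α := α) (C := C) (h₀ := h₀) (J := J) (M := M) hn1 hα hα'
    (by rw [← hR, hRL]; exact hR4) (by rw [← hR, hRL]; exact hRα) hh0
    (by rw [hexp0, ← hc, mul_div_cancel₀ _ hc0.ne']) hJ1 hJ2 hM1
  have hEpos := Real.exp_pos (C / 2)
  have hLγ : L ≤ L ^ γ := Real.self_le_rpow_of_one_le hL1 hγ1
  have hq2 : q ≤ a * L ^ γ + 4 * L := by
    have h1 : 8 * Real.exp (R / 2 - h₀) ≤ sectorCount R h₀ := Nat.le_ceil _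
    rw [Real.exp_sub, exp_half_discRadius hn1, hexph] at h1
    have : 2 * (n * (1 / sectorCount R h₀) : ℝ) ≤
        2 * (n * (1 / (8 * (n * Real.exp (C / 2) / ((4 / c) ^ γ * L ^ γ))))) := by gcongr
    have h2 : 2 * (n * (1 / (8 * (n * Real.exp (C / 2) / ((4 / c) ^ γ * L ^ γ))))) = a * L ^ γ := by
      rw [ha]; field_simp; ring
    rw [hq]
    linarith
  have hJ3 : (J : ℝ) ≤ L + |C| / 2 + 1 := by
    have := le_abs_self C
    rw [hRL] at hJ2
    linarith
  have hdiam : ((2 * (3 * M + 1 + J) + 1 : ℕ) : ℝ) ≤ (6 * a + 31 + |C|) * L ^ γ := by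
    push_cast
    have := abs_nonneg C
    nlinarith
  refine (measure_mono ?_).trans (hmain.trans (ENNReal.ofReal_le_ofReal ?_))
  · intro p hp h
    exact hp fun K _ => (Nat.cast_le.2 (h K)).trans hdiam
  · have hs : (sectorCount R h₀ : ℝ) ≤ 11 * (n * Real.exp (C / 2)) := by
      refine (sectorCount_le (by rw [hRL]; linarith)).trans ?_
      rw [← exp_half_discRadius hn1]
      gcongr
      linarith
    have hLn : L ≤ n := by
      have := Real.log_le_sub_one_of_pos (zero_lt_one.trans_le hn')
      linarith
    have hJn : (J : ℝ) + 2 ≤ (|C| + 4) * n := by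
      have := abs_nonneg C
      nlinarith
    have hpow : Real.exp (-(4 * L)) = (n : ℝ) ^ (-4 : ℝ) := by
      rw [Real.rpow_def_of_pos (by linarith), ← hL]; ring_nf
    -- The union bound gives `n ^ (-2)`, which is stronger than the required `n ^ (-3/2)`.
    calc ((J : ℝ) + 2) * sectorCount R h₀ * Real.exp (-(4 * L))
        ≤ ((|C| + 4) * n) * (11 * (n * Real.exp (C / 2))) * Real.exp (-(4 * L)) := by gcongr
      _ = (|C| + 4) * (11 * Real.exp (C / 2)) * (n : ℝ) ^ (-2 : ℝ) := by
        have : (n : ℝ) ^ (-2 : ℝ) = (n : ℝ) ^ (2 : ℝ) * (n : ℝ) ^ (-4 : ℝ) := by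
          rw [← Real.rpow_add (by linarith)]; norm_num
        rw [hpow, this, Real.rpow_two]; ring
      _ ≤ (|C| + 4) * (11 * Real.exp (C / 2)) * (n : ℝ) ^ (-(3 / 2) : ℝ) := by
        gcongr
        norm_num
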